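/- Let $M$ be an analytic space (i.e. homeomorphic to the image of a Polish space under a continuous map between Polish spaces), $\Sigma$ its Borel $\sigma$-algebra, and $\theta$ a measurable map from $M$ to the finite measures on $(M,\Sigma)$, where the space of measures carries the $\sigma$-algebra generated by the sets $\{\mu : \mu(S)\ge r\}$ for $S\in\Sigma$, $r>0$. A relation $R\subseteq M\times M$ is a *stochastic bisimulation relation* if, whenever $(m,n)\in R$, $\theta(m)(C)=\theta(n)(C)$ for every $C\in\Sigma$ that is $R$-closed ($x\in C$ and $(x,y)\in R$ imply $y\in C$). States $m,n$ are *stochastically bisimilar*, $m\sim n$, if some stochastic bisimulation relation contains $(m,n)$. Let $G$ be the smallest family of subsets of $M$ that contains $M$, is closed under finite (binary) unions and intersections, and contains $\{x\in M : \theta(x)(C)\ge r\}$ whenever $C\in G$ and $r\in\mathbb{Q}_{\ge 0}$. For rational $\varepsilon\ge 0$, a relation $R\subseteq M\times M$ is an *$\varepsilon$-behavioral order* if it is closed under bisimulation ($m\mathrel{R}n$, $m\sim m'$ and $n\sim n'$ imply $m'\mathrel{R}n'$) and $m\mathrel{R}n$ implies, for every $C\in G$, $$\theta(n)(C)-\theta(m)(C^R)\le\varepsilon,\qquad\text{where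 } C^R=\{x\in M : x\mathrel{R}y\text{ for some }y\in C\},$$ and where $\theta(m)(C^R)$ denotes the outer measure of $C^R$ if $C^R$ is not measurable. Let $\prec_\varepsilon$ be the largest $\varepsilon$-behavioral order, i.e. the union of all of them (this union is again an $\varepsilon$-behavioral order). **Theorem (Pseudometric).** For all $m,n\in M$ the set $\{\varepsilon\in\mathbb{Q}_{\ge 0} : m\prec_\varepsilon n\text{ and }n\prec_\varepsilon m\}$ is non-empty, and the function $$d(m,n)=\inf\{\varepsilon\in\mathbb{Q}_{\ge 0} : m\prec_\varepsilon n\text{ and }n\prec_\varepsilon m\}$$ is a pseudometric on $M$ with values in $\mathbb{R}_{\ge 0}$: $d(m,m)=0$, $d(m,n)=d(n,m)$ and $d(m,o)\le d(m,n)+d(n,o)$ for all $m,n,o\in M$. Moreover, for all $m,n\in M$, $d(m,n)=0$ if and only if $m\sim n$. -/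

import Mathlib

open MeasureTheory ProbabilityTheory Set
open scoped NNRat

universe u

/-- `M` is (homeomorphic to) an analytic subset of a Polish space, that is, to the image of a
Polish space under a continuous map between Polish spaces. -/
def IsAnalyticSpace (M : Type u) [TopologicalSpace M] : Prop :=
  ∃ (Y : Type u) (_ : TopologicalSpace Y) (_ : PolishSpace Y) (e : M → Y),
    Topology.IsEmbedding e ∧ AnalyticSet (range e)

/-- A continuous Markov kernel on an analytic space `M` with its Borel `σ`-algebra: a measurable
map `θ` from `M` to the space of measures on `M` with finite values (no bound that is uniform in
the state is required). -/
structure CMK (M : Type u) [TopologicalSpace M] [MeasurableSpace M] [BorelSpace M] where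
  analytic : IsAnalyticSpace M
  θ : Kernel M M
  finite : ∀ m, IsFiniteMeasure (θ m)

namespace CMK

variable {M : Type u} [TopologicalSpace M] [MeasurableSpace M] [BorelSpace M]

/-- `R` is a stochastic bisimulation relation: related states give the same measure to every
measurable `R`-closed set. -/
def IsBisimulation (K : CMK M) (R : M → M → Prop) : Prop :=
  ∀ m n, R m n → ∀ C : Set M, MeasurableSet C → (∀ x ∈ C, ∀ y, R x y → y ∈ C) →
    K.θ m C = K.θ n C

/-- Stochastic bisimilarity of states. -/
def Bisimilar (K : CMK M) (m n : M) : Prop :=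
  ∃ R : M → M → Prop, K.IsBisimulation R ∧ R m n

/-- The bisimulation generator: the least family of sets of states that contains the whole space,
is closed under (binary) unions and intersections, and contains with each `C` the sets
`{x | θ(x)(C) ≥ r}` for rational `r ≥ 0`. -/
inductive Generator (K : CMK M) : Set M → Prop
  | univ : Generator K Set.univ
  | inter (C D : Set M) : Generator K C → Generator K D → Generator K (C ∩ D)
  | union (C D : Set M) : Generator K C → Generator K D → Generator K (C ∪ D)
  | rate (r : ℚ≥0) (C : Set M) : Generator K C → Generator K {x | (r : ℝ) ≤ (K.θ x).real C}

/-- The closure of a set of states under `R`, in the direction used by behavioral orders: the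
states that lie `R`-below some element of `C`. -/
def lowerClosure (R : M → M → Prop) (C : Set M) : Set M :=
  {x | ∃ y ∈ C, R x y}

/-- `R` is an `ε`-behavioral order. The closure of `C` need not be a Borel set for an arbitrary
`R`; its measure is then the outer measure. -/
structure IsBehavioralOrder (K : CMK M) (ε : ℚ≥0) (R : M → M → Prop) : Prop where
  bisimClosed : ∀ m m' n n', K.Bisimilar m m' → K.Bisimilar n n' → R m n → R m' n'
  rate_le : ∀ m n, R m n → ∀ C, K.Generator C →
    (K.θ n).real C - (K.θ m).real (lowerClosure R C) ≤ (ε : ℝ)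

/-- The union of all `ε`-behavioral orders. -/
def Prec (K : CMK M) (ε : ℚ≥0) (m n : M) : Prop :=
  ∃ R : M → M → Prop, K.IsBehavioralOrder ε R ∧ R m n

/-- `Prec K ε` is an `ε`-behavioral order, hence the largest one. -/
theorem isBehavioralOrder_prec (K : CMK M) (ε : ℚ≥0) : K.IsBehavioralOrder ε (K.Prec ε) where
  bisimClosed := by
    rintro m m' n n' hm hn ⟨R, hR, h⟩
    exact ⟨R, hR, hR.bisimClosed m m' n n' hm hn h⟩
  rate_le := by
    rintro m n ⟨R, hR, h⟩ C hC
    have h1 := hR.rate_le m n h C hC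
    have : IsFiniteMeasure (K.θ m) := K.finite m
    have h2 : (K.θ m).real (lowerClosure R C) ≤ (K.θ m).real (lowerClosure (K.Prec ε) C) := by
      apply measureReal_mono _ (measure_ne_top _ _)
      rintro x ⟨y, hy, hxy⟩
      exact ⟨y, hy, R, hR, hxy⟩
    linarith

/-- The rationals `ε ≥ 0` with `m ≺_ε n` and `n ≺_ε m`, as real numbers. -/
def distSet (K : CMK M) (m n : M) : Set ℝ :=
  {x | ∃ ε : ℚ≥0, x = (ε : ℝ) ∧ K.Prec ε m n ∧ K.Prec ε n m}

/-- The behavioral distance. -/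
noncomputable def d (K : CMK M) (m n : M) : ℝ :=
  sInf (K.distSet m n)

end CMK

/-!
The sets in the generator are the extensions `⟦φ⟧` of the formulas `φ` of a countable positive
logic with conjunctions, disjunctions and modalities `⟨r⟩φ`, the latter true at `x` when
`θ(x)⟦φ⟧ ≥ r`. Let `φ^ε` be the formula `φ` with every threshold `r` lowered to `r - ε` (truncated
at `0`). The core of the proof is a logical description of the largest `ε`-behavioral order:

  `m ≺_ε n` if and only if, for every `φ`, `n ⊨ φ` implies `m ⊨ φ^ε` (`prec_iff_logPrec`).

Since `(φ^δ)^ε = φ^(δ+ε)`, the triangle inequality is then immediate. The distance of `m` and `n`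
vanishes iff they satisfy the same formulas, since `⟦φ⟧` is the intersection of the sets `⟦φ^ε⟧`
over `ε > 0`, by continuity of finite measures from above; and states that satisfy the same
formulas are bisimilar, since by Lusin's separation theorem every measurable set that is invariant
under logical equivalence lies in the `σ`-algebra generated by the sets `⟦φ⟧`, a `π`-system on
which the two measures agree.

The implication from left to right in the logical description is an induction on `φ`. For the
converse (`LogPrec.theta_le`), one has to bound the measure of `C = ⟦φ⟧` at `n` by the outer measure
of its closure `C^R` at `m`, where `R` is the relation described logically. As `M` is analytic, it
is the image of Baire space under a map `h` for which all `h ⁻¹' ⟦ψ⟧` are open and closed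
(`exists_surjective_isClopen_preimage_sem`). The usual capacity argument gives a compact set `L`
of the form `{σ | σ ≤ k}` such that every `ψ` which holds on `C ∩ h(L)` has `θ(n)⟦ψ⟧`
nearly as large as `θ(n)(C)`. If `x ∉ C^R`, each `y ∈ C` has a formula `ψ_y` with `y ⊨ ψ_y` and
`x ⊭ ψ_y^ε`; by compactness finitely many of the `ψ_y` cover `C ∩ h(L)`, and their disjunction is a
`ψ` that holds on `C ∩ h(L)` and has `x ⊭ ψ^ε`. So the intersection of the countable directed
family of the sets `⟦ψ^ε⟧`, over all `ψ` that hold on `C ∩ h(L)`, is contained in `C^R`,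
and continuity from above concludes.
-/

namespace CMK

/-! ### Bounded sets in Baire space -/

theorem isCompact_setOf_forall_le (k : ℕ → ℕ) : IsCompact {σ : ℕ → ℕ | ∀ i, σ i ≤ k i} := by
  have := isCompact_univ_pi (s := fun i => Iic (k i)) fun i => (finite_Iic (k i)).isCompact
  convert this using 1
  ext σ
  simp [Pi.le_def]

/-- An open set that contains the compact set `{σ | σ ≤ k}` contains the set of all sequences of
which only finitely many coordinates are bounded by `k`. -/
theorem exists_bounded_prefix_subset (k : ℕ → ℕ) {U : Set (ℕ → ℕ)} (hU : IsOpen U)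
    (h : {σ : ℕ → ℕ | ∀ i, σ i ≤ k i} ⊆ U) :
    ∃ j, {σ : ℕ → ℕ | ∀ i < j, σ i ≤ k i} ⊆ U := by
  obtain ⟨j, hj⟩ := (isCompact_setOf_forall_le k).elim_directed_cover
    (fun j => {σ | PiNat.cylinder σ j ⊆ U})
    (by
      intro j
      rw [isOpen_iff_mem_nhds]
      intro σ hσ
      filter_upwards [(PiNat.isOpen_cylinder (fun _ => ℕ) σ j).mem_nhds
        (PiNat.self_mem_cylinder σ j)] with τ hτ
      rw [PiNat.mem_cylinder_iff_eq.1 hτ]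
      exact hσ)
    (by
      intro σ hσ
      obtain ⟨_, ⟨⟨τ, j, rfl⟩, hστ, hτU⟩⟩ :=
        (PiNat.isTopologicalBasis_cylinders (fun _ => ℕ)).exists_subset_of_mem_open (h hσ) hU
      refine mem_iUnion.2 ⟨j, ?_⟩
      change PiNat.cylinder σ j ⊆ U
      rw [PiNat.mem_cylinder_iff_eq.1 hστ]
      exact hτU)
    (directed_of_isDirected_le fun a b hab σ hσ =>
      (PiNat.cylinder_anti σ hab).trans hσ)
  refine ⟨j, fun σ hσ => ?_⟩
  -- Truncating `σ` at `k` does not change its first `j` coordinates.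
  have h1 : (fun i => min (σ i) (k i)) ∈ {σ : ℕ → ℕ | ∀ i, σ i ≤ k i} := fun i => min_le_right _ _
  refine hj h1 ?_
  intro i hi
  exact (min_eq_left (hσ i hi)).symm

/-- The capacity argument: if `A` has measure larger than `c` and is covered by an image of Baire
space, the coordinates can be bounded one after the other so that at every stage the outer measure
of the remaining part of `A` is still larger than `c`. -/
theorem exists_bounds_lt_measure {α : Type*} [MeasurableSpace α] (μ : Measure α)
    (h : (ℕ → ℕ) → α) (hs : Function.Surjective h) (A : Set α) {c : ENNReal} (hc : c < μ A) :
    ∃ k : ℕ → ℕ, ∀ j, c < μ (A ∩ h '' {σ | ∀ i < j, σ i ≤ k i}) := by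
  have step : ∀ (j : ℕ) (k : ℕ → ℕ), c < μ (A ∩ h '' {σ | ∀ i < j, σ i ≤ k i}) →
      ∃ p, c < μ (A ∩ h '' {σ | ∀ i < j + 1, σ i ≤ Function.update k j p i}) := by
    intro j k hk
    have hupd : ∀ p, {σ : ℕ → ℕ | ∀ i < j + 1, σ i ≤ Function.update k j p i} =
        {σ : ℕ → ℕ | (∀ i < j, σ i ≤ k i) ∧ σ j ≤ p} := by
      intro p
      ext σ
      simp only [mem_ofPred_eq]
      constructor
      · intro H
        refine ⟨fun i hi => ?_, by simpa using H j (Nat.lt_succ_self j)⟩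
        simpa [Function.update_of_ne hi.ne] using H i (by omega)
      · rintro ⟨H, H'⟩ i hi
        rcases Nat.lt_succ_iff_lt_or_eq.1 hi with hi | rfl
        · simpa [Function.update_of_ne hi.ne] using H i hi
        · simpa using H'
    have hmono : Monotone fun p => A ∩ h '' {σ | (∀ i < j, σ i ≤ k i) ∧ σ j ≤ p} := by
      intro p q hpq
      exact inter_subset_inter_right _ (image_mono fun σ hσ => ⟨hσ.1, hσ.2.trans hpq⟩)
    have hU : A ∩ h '' {σ | ∀ i < j, σ i ≤ k i} =
        ⋃ p, A ∩ h '' {σ | (∀ i < j, σ i ≤ k i) ∧ σ j ≤ p} := by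
      ext x
      simp only [mem_inter_iff, mem_image, mem_iUnion, mem_ofPred_eq]
      constructor
      · rintro ⟨hx, σ, hσ, rfl⟩
        exact ⟨σ j, hx, σ, ⟨hσ, le_rfl⟩, rfl⟩
      · rintro ⟨p, hx, σ, hσ, rfl⟩
        exact ⟨hx, σ, hσ.1, rfl⟩
    rw [hU, hmono.measure_iUnion, lt_iSup_iff] at hk
    obtain ⟨p, hp⟩ := hk
    exact ⟨p, by rw [hupd p]; exact hp⟩
  choose! p hp using step
  -- `k j` carries the bounds for the coordinates below `j`; later stages leave these unchanged.
  let k : ℕ → ℕ → ℕ := fun j => Nat.rec 0 (fun j k => Function.update k j (p j k)) j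
  have hk : ∀ j, k (j + 1) = Function.update (k j) j (p j (k j)) := fun j => rfl
  have hk1 : ∀ j, c < μ (A ∩ h '' {σ | ∀ i < j, σ i ≤ k j i}) := by
    intro j
    induction j with
    | zero => simpa [image_univ, hs.range_eq] using hc
    | succ j ih => rw [hk]; exact hp j (k j) ih
  have hk2 : ∀ i j, i < j → k j i = k (i + 1) i := by
    intro i j hij
    induction j, hij using Nat.le_induction with
    | base => rfl
    | succ j hj ih => rw [hk, Function.update_of_ne (by omega), ih]
  refine ⟨fun i => k (i + 1) i, fun j => ?_⟩
  have : {σ : ℕ → ℕ | ∀ i < j, σ i ≤ k (i + 1) i} = {σ : ℕ → ℕ | ∀ i < j, σ i ≤ k j i} := by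
    ext σ
    exact forall₂_congr fun i hi => by rw [hk2 i j hi]
  rw [this]
  exact hk1 j

/-! ### Parametrization of analytic spaces -/

/-- An analytic space is a continuous image of Baire space. -/
theorem exists_continuous_surjective_of_isAnalyticSpace {M : Type u} [TopologicalSpace M]
    [Nonempty M] (hM : IsAnalyticSpace M) :
    ∃ h : (ℕ → ℕ) → M, Continuous h ∧ Function.Surjective h := by
  obtain ⟨Y, _, _, e, he, hA⟩ := hM
  rw [analyticSet_iff_exists_polishSpace_range] at hA
  obtain ⟨Z, _, _, f, hf, hfe⟩ := hA
  have : Nonempty Z := by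
    have : (range f).Nonempty := hfe ▸ range_nonempty e
    exact this.to_subtype.elim fun y => ⟨y.2.choose⟩
  obtain ⟨g, hg, hgs⟩ := PolishSpace.exists_nat_nat_continuous_surjective Z
  have hmem : ∀ σ, ∃ x, e x = f (g σ) := fun σ => by
    rw [← mem_range, ← hfe]
    exact mem_range_self _
  choose h hh using hmem
  refine ⟨h, ?_, fun x => ?_⟩
  · rw [he.isInducing.continuous_iff]
    have : e ∘ h = f ∘ g := funext hh
    rw [this]
    exact hf.comp hg
  · obtain ⟨z, hz⟩ : e x ∈ range f := hfe ▸ mem_range_self x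
    obtain ⟨σ, rfl⟩ := hgs z
    exact ⟨σ, he.injective ((hh σ).trans hz)⟩

/-- Countably many Borel sets of a Polish space become open and closed in a suitable
parametrization by Baire space. -/
theorem exists_surjective_isClopen_preimage {X ι : Type*} [t : TopologicalSpace X] [PolishSpace X]
    [MeasurableSpace X] [BorelSpace X] [Nonempty X] [Countable ι] (A : ι → Set X)
    (hA : ∀ i, MeasurableSet (A i)) :
    ∃ g : (ℕ → ℕ) → X, Function.Surjective g ∧ ∀ i, IsClopen (g ⁻¹' A i) := by
  -- Refine the topology so that the sets become clopen, and parametrize the resulting Polish space.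
  choose T hT hTp hTc hTo using fun i => (hA i).isClopenable
  obtain ⟨t', ht', -, hp⟩ := PolishSpace.exists_polishSpace_forall_le T hT hTp
  obtain ⟨g, hg, hgs⟩ := @PolishSpace.exists_nat_nat_continuous_surjective X t' hp _
  have hpre : ∀ V, @IsOpen X t' V → IsOpen (g ⁻¹' V) := fun V hV =>
    @IsOpen.preimage _ _ _ t' _ hg V hV
  refine ⟨g, hgs, fun i => ⟨IsClosed.mk ?_, hpre _ (ht' i _ (hTo i))⟩⟩
  exact hpre (A i)ᶜ (ht' i _ (@IsClosed.isOpen_compl _ (T i) _ (hTc i)))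

/-! ### Formulas -/

/-- Formulas of the positive logic that describes the bisimulation generator. -/
inductive Formula
  | top
  | and (φ ψ : Formula)
  | or (φ ψ : Formula)
  | rate (r : ℚ≥0) (φ : Formula)
  deriving Countable

namespace Formula

/-- The formula `φ^ε`: all thresholds are lowered by `ε`, with truncation at `0`. -/
def shift (ε : ℚ≥0) : Formula → Formula
  | top => top
  | and φ ψ => and (φ.shift ε) (ψ.shift ε)
  | or φ ψ => or (φ.shift ε) (ψ.shift ε)
  | rate r φ => rate (r - ε) (φ.shift ε)

theorem shift_shift (δ ε : ℚ≥0) (φ : Formula) : (φ.shift δ).shift ε = φ.shift (δ + ε) := by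
  induction φ with
  | top => rfl
  | and φ ψ h1 h2 => simp [shift, h1, h2]
  | or φ ψ h1 h2 => simp [shift, h1, h2]
  | rate r φ h => simp [shift, h, tsub_tsub]

end Formula

variable {M : Type u} [TopologicalSpace M] [MeasurableSpace M] [BorelSpace M] (K : CMK M)

instance isFiniteMeasure_theta (m : M) : IsFiniteMeasure (K.θ m) := K.finite m

/-- The set of states that satisfy a formula. -/
def sem : Formula → Set M
  | .top => univ
  | .and φ ψ => sem φ ∩ sem ψ
  | .or φ ψ => sem φ ∪ sem ψ
  | .rate r φ => {x | (r : ℝ) ≤ (K.θ x).real (sem φ)}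

theorem generator_sem (φ : Formula) : K.Generator (K.sem φ) := by
  induction φ with
  | top => exact .univ
  | and φ ψ h1 h2 => exact .inter _ _ h1 h2
  | or φ ψ h1 h2 => exact .union _ _ h1 h2
  | rate r φ h => exact .rate r _ h

theorem Generator.exists_sem {C : Set M} (hC : K.Generator C) : ∃ φ, K.sem φ = C := by
  induction hC with
  | univ => exact ⟨.top, rfl⟩
  | inter C D _ _ h1 h2 =>
    obtain ⟨φ, rfl⟩ := h1
    obtain ⟨ψ, rfl⟩ := h2
    exact ⟨.and φ ψ, rfl⟩
  | union C D _ _ h1 h2 =>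
    obtain ⟨φ, rfl⟩ := h1
    obtain ⟨ψ, rfl⟩ := h2
    exact ⟨.or φ ψ, rfl⟩
  | rate r C _ h =>
    obtain ⟨φ, rfl⟩ := h
    exact ⟨.rate r φ, rfl⟩

theorem measurableSet_sem (φ : Formula) : MeasurableSet (K.sem φ) := by
  induction φ with
  | top => exact .univ
  | and φ ψ h1 h2 => exact h1.inter h2
  | or φ ψ h1 h2 => exact h1.union h2
  | rate r φ h =>
    exact measurableSet_le measurable_const (K.θ.measurable_coe h).ennreal_toReal

theorem coe_tsub_le_iff (r ε : ℚ≥0) {a : ℝ} (ha : 0 ≤ a) :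
    ((r - ε : ℚ≥0) : ℝ) ≤ a ↔ (r : ℝ) ≤ a + ε := by
  rcases le_total r ε with h | h
  · rw [tsub_eq_zero_of_le h]
    have : (r : ℝ) ≤ ε := by exact_mod_cast h
    simp only [NNRat.cast_zero, ha, true_iff]
    linarith
  · have h1 : ((r - ε : ℚ≥0) : ℝ) + ε = r := by
      rw [← NNRat.cast_add, tsub_add_cancel_of_le h]
    constructor <;> intro h <;> linarith

theorem sem_shift_mono {δ ε : ℚ≥0} (h : δ ≤ ε) (φ : Formula) :
    K.sem (φ.shift δ) ⊆ K.sem (φ.shift ε) := by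
  induction φ with
  | top => exact subset_rfl
  | and φ ψ h1 h2 => exact inter_subset_inter h1 h2
  | or φ ψ h1 h2 => exact union_subset_union h1 h2
  | rate r φ ih =>
    intro x hx
    have h1 : ((r - ε : ℚ≥0) : ℝ) ≤ ((r - δ : ℚ≥0) : ℝ) := by
      exact_mod_cast tsub_le_tsub_left h r
    exact h1.trans (hx.trans (measureReal_mono ih))

/-- A formula holds at every state where all of its relaxations by `1 / (k + 1)` hold. -/
theorem iInter_sem_shift_subset (φ : Formula) :
    ⋂ k : ℕ, K.sem (φ.shift (1 / (k + 1))) ⊆ K.sem φ := by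
  have hanti : ∀ φ : Formula, Antitone fun k : ℕ => K.sem (φ.shift (1 / (k + 1))) := by
    intro φ a b hab
    apply K.sem_shift_mono
    have : (a : ℚ≥0) ≤ b := by exact_mod_cast hab
    gcongr
  induction φ with
  | top => exact fun _ _ => mem_univ _
  | and φ ψ h1 h2 =>
    intro x hx
    exact ⟨h1 (mem_iInter.2 fun k => (mem_iInter.1 hx k).1),
      h2 (mem_iInter.2 fun k => (mem_iInter.1 hx k).2)⟩
  | or φ ψ h1 h2 =>
    intro x hx
    by_contra hn
    have hn1 : x ∉ ⋂ k : ℕ, K.sem (φ.shift (1 / (k + 1))) := fun h => hn (Or.inl (h1 h))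
    have hn2 : x ∉ ⋂ k : ℕ, K.sem (ψ.shift (1 / (k + 1))) := fun h => hn (Or.inr (h2 h))
    simp only [mem_iInter, not_forall] at hn1 hn2
    obtain ⟨a, ha⟩ := hn1
    obtain ⟨b, hb⟩ := hn2
    rcases mem_iInter.1 hx (max a b) with h | h
    · exact ha (hanti φ (le_max_left a b) h)
    · exact hb (hanti ψ (le_max_right a b) h)
  | rate r φ ih =>
    intro x hx
    have hlim : Filter.Tendsto (fun k : ℕ => (K.θ x).real (K.sem (φ.shift (1 / (k + 1)))))
        Filter.atTop (nhds ((K.θ x).real (⋂ k : ℕ, K.sem (φ.shift (1 / (k + 1)))))) :=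
      (ENNReal.tendsto_toReal (measure_ne_top _ _)).comp
        (tendsto_measure_iInter_atTop (fun k => (K.measurableSet_sem _).nullMeasurableSet)
          (hanti φ) ⟨0, measure_ne_top _ _⟩)
    have hlim' := hlim.add tendsto_one_div_add_atTop_nhds_zero_nat
    rw [add_zero] at hlim'
    refine (ge_of_tendsto' hlim' fun k => ?_).trans (measureReal_mono ih)
    have := (coe_tsub_le_iff _ _ measureReal_nonneg).1 (mem_iInter.1 hx k)
    simpa using this

/-! ### Bisimilarity and logical equivalence -/

theorem isBisimulation_bisimilar : K.IsBisimulation K.Bisimilar := by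
  rintro m n ⟨R, hR, h⟩ C hC hcl
  exact hR m n h C hC fun x hx y hxy => hcl x hx y ⟨R, hR, hxy⟩

theorem Bisimilar.refl (m : M) : K.Bisimilar m m :=
  ⟨Eq, by rintro m _ rfl C _ _; rfl, rfl⟩

variable {K}

theorem Bisimilar.symm {m n : M} (h : K.Bisimilar m n) : K.Bisimilar n m := by
  obtain ⟨R, hR, h⟩ := h
  refine ⟨fun x y => R y x, fun x y hxy C hC hcl => ?_, h⟩
  -- The complement of a set closed under the converse of `R` is `R`-closed.
  have h1 := hR y x hxy Cᶜ hC.compl fun a ha b hab hb => ha (hcl b hb a hab)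
  have h2 := hR y x hxy univ .univ fun _ _ _ _ => mem_univ _
  rw [← compl_compl C, measure_compl hC.compl (measure_ne_top _ _),
    measure_compl hC.compl (measure_ne_top _ _), h1, h2]

theorem Bisimilar.trans {m n o : M} (h1 : K.Bisimilar m n) (h2 : K.Bisimilar n o) :
    K.Bisimilar m o := by
  refine ⟨fun x z => ∃ y, K.Bisimilar x y ∧ K.Bisimilar y z, ?_, n, h1, h2⟩
  rintro x z ⟨y, hxy, hyz⟩ C hC hcl
  have hcl' : ∀ a ∈ C, ∀ b, K.Bisimilar a b → b ∈ C := fun a ha b hab =>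
    hcl a ha b ⟨b, hab, .refl K b⟩
  exact (K.isBisimulation_bisimilar x y hxy C hC hcl').trans
    (K.isBisimulation_bisimilar y z hyz C hC hcl')

theorem Bisimilar.mem_sem {m n : M} (h : K.Bisimilar m n) {φ : Formula} (hm : m ∈ K.sem φ) :
    n ∈ K.sem φ := by
  induction φ generalizing m n with
  | top => exact mem_univ _
  | and φ ψ h1 h2 => exact ⟨h1 h hm.1, h2 h hm.2⟩
  | or φ ψ h1 h2 => exact hm.imp (h1 h) (h2 h)
  | rate r φ ih =>
    have := K.isBisimulation_bisimilar m n h _ (K.measurableSet_sem φ)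
      fun x hx y hxy => ih hxy hx
    change (r : ℝ) ≤ (K.θ n).real (K.sem φ)
    rw [measureReal_def, ← this]
    exact hm

variable (K)

open Classical in
/-- The theory of a state, as a point of a product of two-point spaces. -/
noncomputable def theory (x : M) : Formula → Bool := fun φ => decide (x ∈ K.sem φ)

theorem theory_preimage (φ : Formula) :
    (fun x => K.theory x φ) ⁻¹' {true} = K.sem φ := by
  ext x
  simp [theory]

/-- A measurable set that is invariant under logical equivalence is measurable for the `σ`-algebra
generated by the formulas: the images under `theory` of the set and of its complement are disjoint
analytic sets, which a Borel set separates. -/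
theorem measurableSet_generateFrom_sem {C : Set M} (hC : MeasurableSet C)
    (hcl : ∀ x y, (∀ φ, x ∈ K.sem φ ↔ y ∈ K.sem φ) → x ∈ C → y ∈ C) :
    MeasurableSet[MeasurableSpace.generateFrom (range K.sem)] C := by
  rcases isEmpty_or_nonempty M with hM | hM
  · rw [Set.eq_empty_of_isEmpty C]
    exact @MeasurableSet.empty _ (_)
  obtain ⟨h, hc, hs⟩ := exists_continuous_surjective_of_isAnalyticSpace K.analytic
  have hth : Measurable K.theory := by
    refine measurable_pi_iff.2 fun φ => measurable_to_bool ?_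
    rw [theory_preimage]
    exact K.measurableSet_sem φ
  have himage : ∀ D : Set M, MeasurableSet D → AnalyticSet (K.theory '' D) := by
    intro D hD
    rw [← hs.image_preimage D, ← image_comp]
    exact (hc.measurable hD).analyticSet_image (hth.comp hc.measurable)
  have hdisj : Disjoint (K.theory '' C) (K.theory '' Cᶜ) := by
    rw [Set.disjoint_left]
    rintro _ ⟨x, hx, rfl⟩ ⟨y, hy, hxy⟩
    refine hy (hcl x y (fun φ => ?_) hx)
    have := congrFun hxy φ
    simp only [theory, decide_eq_decide] at this
    exact this.symm
  obtain ⟨B, hB1, hB2, hB⟩ := (himage C hC).measurablySeparable (himage Cᶜ hC.compl) hdisj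
  have hCB : C = K.theory ⁻¹' B := by
    ext x
    refine ⟨fun hx => hB1 (mem_image_of_mem _ hx), fun hx => ?_⟩
    by_contra hn
    exact Set.disjoint_left.1 hB2 (mem_image_of_mem _ hn) hx
  rw [hCB]
  have hth' : Measurable[MeasurableSpace.generateFrom (range K.sem)] K.theory := by
    refine (@measurable_pi_iff _ _ _ (_) _ _).2 fun φ => @measurable_to_bool _ (_) _ ?_
    rw [theory_preimage]
    exact MeasurableSpace.measurableSet_generateFrom (mem_range_self φ)
  exact hth' hB

theorem isBisimulation_logicalEquivalence :
    K.IsBisimulation fun x y => ∀ φ, x ∈ K.sem φ ↔ y ∈ K.sem φ := by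
  intro m n hmn C hC hcl
  have hle : ∀ x y : M, (∀ φ, x ∈ K.sem φ ↔ y ∈ K.sem φ) → ∀ φ,
      (K.θ x).real (K.sem φ) ≤ (K.θ y).real (K.sem φ) := by
    intro x y hxy φ
    refine le_of_forall_rat_lt_imp_le fun q hq => ?_
    rcases le_total q 0 with h0 | h0
    · exact (Rat.cast_nonpos.2 h0).trans measureReal_nonneg
    · lift q to ℚ≥0 using h0
      have : x ∈ K.sem (.rate q φ) := by
        change ((q : ℚ≥0) : ℝ) ≤ _
        exact_mod_cast hq.le
      have := (hxy _).1 this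
      change ((q : ℚ≥0) : ℝ) ≤ _ at this
      exact_mod_cast this
  have heq : ∀ φ, K.θ m (K.sem φ) = K.θ n (K.sem φ) := fun φ =>
    (measureReal_eq_measureReal_iff).1
      (le_antisymm (hle m n hmn φ) (hle n m (fun φ => (hmn φ).symm) φ))
  refine ext_on_measurableSpace_of_generate_finite _ (range K.sem) ?_ ?_ rfl ?_ (heq .top)
    (K.measurableSet_generateFrom_sem hC fun x y hxy hx => hcl x hx y hxy)
  · rintro _ ⟨φ, rfl⟩
    exact heq φ
  · exact MeasurableSpace.generateFrom_le fun _ ⟨φ, hφ⟩ => hφ ▸ K.measurableSet_sem φ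
  · rintro _ ⟨φ, rfl⟩ _ ⟨ψ, rfl⟩ -
    exact ⟨.and φ ψ, rfl⟩

/-! ### The logical description of the behavioral order -/

/-- An analytic space is the image of Baire space under a map for which the preimages of the
countably many sets defined by formulas are open and closed. The map need not be continuous. -/
theorem exists_surjective_isClopen_preimage_sem [Nonempty M] :
    ∃ h : (ℕ → ℕ) → M, Function.Surjective h ∧ ∀ φ, IsClopen (h ⁻¹' K.sem φ) := by
  obtain ⟨h, hc, hs⟩ := exists_continuous_surjective_of_isAnalyticSpace K.analytic
  obtain ⟨g, hgs, hg⟩ := exists_surjective_isClopen_preimage (fun φ => h ⁻¹' K.sem φ)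
    fun φ => hc.measurable (K.measurableSet_sem φ)
  exact ⟨h ∘ g, hs.comp hgs, hg⟩

/-- The logical behavioral order: the lower state satisfies the `ε`-relaxation of every formula that
the upper state satisfies. -/
def LogPrec (ε : ℚ≥0) (m n : M) : Prop :=
  ∀ φ, n ∈ K.sem φ → m ∈ K.sem (φ.shift ε)

variable {K}

theorem LogPrec.trans {δ ε : ℚ≥0} {m n o : M} (h1 : K.LogPrec ε m n) (h2 : K.LogPrec δ n o) :
    K.LogPrec (ε + δ) m o := by
  intro φ hφ
  rw [add_comm, ← Formula.shift_shift]
  exact h1 _ (h2 _ hφ)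

theorem IsBehavioralOrder.logPrec {ε : ℚ≥0} {R : M → M → Prop} (hR : K.IsBehavioralOrder ε R)
    {m n : M} (h : R m n) : K.LogPrec ε m n := by
  intro φ
  induction φ generalizing m n with
  | top => exact fun _ => mem_univ _
  | and φ ψ h1 h2 => exact fun hn => ⟨h1 h hn.1, h2 h hn.2⟩
  | or φ ψ h1 h2 => exact fun hn => hn.imp (h1 h) (h2 h)
  | rate r φ ih =>
    intro hn
    refine (coe_tsub_le_iff _ _ measureReal_nonneg).2 ?_
    have h1 := hR.rate_le m n h _ (K.generator_sem φ)
    have h2 : (K.θ m).real (lowerClosure R (K.sem φ)) ≤ (K.θ m).real (K.sem (φ.shift ε)) :=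
      measureReal_mono fun x ⟨y, hy, hxy⟩ => ih hxy hy
    have h3 : (r : ℝ) ≤ (K.θ n).real (K.sem φ) := hn
    linarith

theorem LogPrec.theta_sem_le {ε : ℚ≥0} {m n : M} (h : K.LogPrec ε m n) (φ : Formula) :
    (K.θ n).real (K.sem φ) ≤ (K.θ m).real (K.sem (φ.shift ε)) + ε := by
  refine le_of_forall_rat_lt_imp_le fun q hq => ?_
  rcases le_total q 0 with h0 | h0
  · exact (Rat.cast_nonpos.2 h0).trans (add_nonneg measureReal_nonneg ε.cast_nonneg)
  · lift q to ℚ≥0 using h0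
    have : n ∈ K.sem (.rate q φ) := by
      change ((q : ℚ≥0) : ℝ) ≤ _
      exact_mod_cast hq.le
    have := (coe_tsub_le_iff _ _ measureReal_nonneg).1 (h _ this)
    exact_mod_cast this

/-- Logically related states satisfy the measure inequality that defines an `ε`-behavioral order. -/
theorem LogPrec.theta_le {ε : ℚ≥0} {m n : M} (hmn : K.LogPrec ε m n) (φ : Formula) :
    (K.θ n).real (K.sem φ) - (K.θ m).real (lowerClosure (K.LogPrec ε) (K.sem φ)) ≤ ε := by
  have : Nonempty M := ⟨m⟩
  obtain ⟨h, hs, hcl⟩ := K.exists_surjective_isClopen_preimage_sem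
  set A := lowerClosure (K.LogPrec ε) (K.sem φ)
  suffices H : K.θ n (K.sem φ) ≤ K.θ m A + ENNReal.ofReal ε by
    have := ENNReal.toReal_mono (by finiteness) H
    rw [ENNReal.toReal_add (by finiteness) (by finiteness),
      ENNReal.toReal_ofReal ε.cast_nonneg] at this
    simp only [measureReal_def]
    linarith
  refine le_of_forall_lt fun c hc => ?_
  obtain ⟨c', hcc', hc'⟩ := exists_between hc
  refine hcc'.trans_le ?_
  obtain ⟨k, hk⟩ := exists_bounds_lt_measure (K.θ n) h hs _ hc'
  -- The formulas that hold on the part of `⟦φ⟧` parametrized by the compact set `{σ | σ ≤ k}`.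
  let S : Set Formula := {ψ | ∀ σ : ℕ → ℕ, (∀ i, σ i ≤ k i) → h σ ∈ K.sem φ → h σ ∈ K.sem ψ}
  have hSc : ∀ ψ ∈ S, c' ≤ K.θ n (K.sem ψ) := by
    intro ψ hψ
    obtain ⟨j, hj⟩ := exists_bounded_prefix_subset k
      (U := h ⁻¹' K.sem ψ ∪ (h ⁻¹' K.sem φ)ᶜ)
      ((hcl ψ).isOpen.union (hcl φ).compl.isOpen)
      (fun σ hσ => or_iff_not_imp_right.2 fun h' => hψ σ hσ (not_not.1 h'))
    refine (hk j).le.trans (measure_mono ?_)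
    rintro _ ⟨hx, σ, hσ, rfl⟩
    exact (hj hσ).resolve_right fun h' => h' hx
  -- `A` need not be measurable, but it contains a countable intersection of sets `⟦ψ^ε⟧`.
  have hsub : ⋂ ψ : S, K.sem (ψ.1.shift ε) ⊆ A := by
    intro x hx
    by_contra hn
    have hsep : ∀ y ∈ K.sem φ, ∃ ψ, y ∈ K.sem ψ ∧ x ∉ K.sem (ψ.shift ε) := by
      intro y hy
      by_contra! H
      exact hn ⟨y, hy, H⟩
    -- As `⟦φ⟧` has positive measure, some formula `ψ` has `x ⊭ ψ^ε`; such formulas are closed under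
    -- disjunction.
    obtain ⟨y, hy⟩ : (K.sem φ).Nonempty :=
      nonempty_of_measure_ne_zero (zero_le.trans_lt hc').ne'
    obtain ⟨ψ₀, -, hψ₀⟩ := hsep y hy
    have : Nonempty {ψ : Formula // x ∉ K.sem (ψ.shift ε)} := ⟨⟨ψ₀, hψ₀⟩⟩
    obtain ⟨⟨ψ, hψx⟩, hψ⟩ :=
      ((isCompact_setOf_forall_le k).inter_right (hcl φ).isClosed).elim_directed_cover
        (fun ψ : {ψ : Formula // x ∉ K.sem (ψ.shift ε)} => h ⁻¹' K.sem ψ.1)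
        (fun ψ => (hcl ψ.1).isOpen)
        (fun σ hσ => by
          obtain ⟨ψ, h1, h2⟩ := hsep (h σ) hσ.2
          exact mem_iUnion.2 ⟨⟨ψ, h2⟩, h1⟩)
        (fun ψ χ => ⟨⟨.or ψ.1 χ.1, fun h => h.elim ψ.2 χ.2⟩,
          fun _ => Or.inl, fun _ => Or.inr⟩)
    exact hψx (mem_iInter.1 hx ⟨ψ, fun σ h1 h2 => hψ ⟨h1, h2⟩⟩)
  have hdir : Directed (fun a b : Set M => a ⊇ b) fun ψ : S => K.sem (ψ.1.shift ε) := by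
    rintro ⟨ψ, hψ⟩ ⟨χ, hχ⟩
    exact ⟨⟨.and ψ χ, fun σ h1 h2 => ⟨hψ σ h1 h2, hχ σ h1 h2⟩⟩,
      inter_subset_left, inter_subset_right⟩
  have : Nonempty S := ⟨⟨.top, fun _ _ _ => mem_univ _⟩⟩
  calc c' ≤ (⨅ ψ : S, K.θ m (K.sem (ψ.1.shift ε))) + ENNReal.ofReal ε := by
        rw [ENNReal.iInf_add]
        refine le_iInf fun ψ => (hSc ψ.1 ψ.2).trans ?_
        have := hmn.theta_sem_le ψ.1
        rw [← ENNReal.ofReal_le_ofReal_iff (by positivity),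
          ENNReal.ofReal_add measureReal_nonneg ε.cast_nonneg, ofReal_measureReal,
          ofReal_measureReal] at this
        exact this
    _ = K.θ m (⋂ ψ : S, K.sem (ψ.1.shift ε)) + ENNReal.ofReal ε := by
        rw [hdir.measure_iInter (fun ψ => (K.measurableSet_sem _).nullMeasurableSet)
          ⟨Classical.arbitrary S, measure_ne_top _ _⟩]
    _ ≤ K.θ m A + ENNReal.ofReal ε := by gcongr

variable (K)

theorem prec_iff_logPrec (ε : ℚ≥0) (m n : M) : K.Prec ε m n ↔ K.LogPrec ε m n := by
  constructor
  · exact fun h => (K.isBehavioralOrder_prec ε).logPrec h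
  · refine fun h => ⟨K.LogPrec ε, ⟨?_, ?_⟩, h⟩
    · exact fun m m' n n' hm hn h φ hφ => hm.mem_sem (h φ (hn.symm.mem_sem hφ))
    · intro m n hmn C hC
      obtain ⟨φ, rfl⟩ := hC.exists_sem
      exact hmn.theta_le φ

/-! ### The pseudometric -/

theorem prec_mono {δ ε : ℚ≥0} (h : δ ≤ ε) {m n : M} (hmn : K.Prec δ m n) : K.Prec ε m n := by
  rw [prec_iff_logPrec] at hmn ⊢
  exact fun φ hφ => K.sem_shift_mono h φ (hmn φ hφ)

/-- States are related at level `ε` as soon as `ε` bounds the total mass at the upper state. -/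
theorem prec_of_measureReal_univ_le {ε : ℚ≥0} {n : M} (h : (K.θ n).real univ ≤ ε) (m : M) :
    K.Prec ε m n := by
  refine ⟨fun _ y => K.Bisimilar n y, ⟨?_, ?_⟩, .refl K n⟩
  · exact fun _ _ _ _ _ hn h => h.trans hn
  · intro x y hxy C _
    have h1 : K.θ n univ = K.θ y univ :=
      K.isBisimulation_bisimilar n y hxy univ .univ fun _ _ _ _ => mem_univ _
    have h2 : (K.θ y).real C ≤ (K.θ y).real univ := measureReal_mono (subset_univ C)
    rw [measureReal_def _ univ, ← h1, ← measureReal_def] at h2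
    have h3 : 0 ≤ (K.θ x).real (lowerClosure (fun _ y => K.Bisimilar n y) C) := measureReal_nonneg
    linarith

theorem distSet_nonempty (m n : M) : (K.distSet m n).Nonempty := by
  obtain ⟨N, hN⟩ := exists_nat_ge (max ((K.θ m).real univ) ((K.θ n).real univ))
  refine ⟨_, N, rfl, K.prec_of_measureReal_univ_le ?_ m, K.prec_of_measureReal_univ_le ?_ n⟩
  · simpa using (le_max_right _ _).trans hN
  · simpa using (le_max_left _ _).trans hN

theorem bddBelow_distSet (m n : M) : BddBelow (K.distSet m n) :=
  ⟨0, by rintro _ ⟨ε, rfl, -⟩; exact ε.cast_nonneg⟩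

theorem d_nonneg (m n : M) : 0 ≤ K.d m n :=
  Real.sInf_nonneg (by rintro _ ⟨ε, rfl, -⟩; exact ε.cast_nonneg)

theorem d_comm (m n : M) : K.d m n = K.d n m := by
  unfold d distSet
  simp only [and_comm]

theorem d_triangle (m n o : M) : K.d m o ≤ K.d m n + K.d n o := by
  refine le_of_forall_pos_lt_add fun η hη => ?_
  obtain ⟨_, ⟨δ, rfl, h1, h2⟩, hδ⟩ :=
    Real.lt_sInf_add_pos (K.distSet_nonempty m n) (half_pos hη)
  obtain ⟨_, ⟨ε, rfl, h3, h4⟩, hε⟩ :=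
    Real.lt_sInf_add_pos (K.distSet_nonempty n o) (half_pos hη)
  simp only [prec_iff_logPrec] at h1 h2 h3 h4
  have h5 : K.d m o ≤ ((δ + ε : ℚ≥0) : ℝ) := by
    refine csInf_le (K.bddBelow_distSet m o) ⟨δ + ε, rfl, ?_, ?_⟩
    · exact (K.prec_iff_logPrec _ _ _).2 (h1.trans h3)
    · exact (K.prec_iff_logPrec _ _ _).2 (add_comm ε δ ▸ h4.trans h2)
  rw [NNRat.cast_add] at h5
  unfold d at h5 ⊢
  linarith

theorem d_eq_zero_iff (m n : M) : K.d m n = 0 ↔ K.Bisimilar m n := by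
  constructor
  · intro h
    have hε : ∀ k : ℕ, K.Prec (1 / (k + 1)) m n ∧ K.Prec (1 / (k + 1)) n m := by
      intro k
      have hpos : (0 : ℝ) < 1 / (k + 1) := Nat.one_div_pos_of_nat
      obtain ⟨_, ⟨δ, rfl, h1, h2⟩, hδ⟩ :=
        Real.lt_sInf_add_pos (K.distSet_nonempty m n) hpos
      rw [← d, h, zero_add] at hδ
      have hle : δ ≤ 1 / (k + 1) := by
        have : (δ : ℝ) ≤ ((1 / (k + 1) : ℚ≥0) : ℝ) := by
          push_cast
          exact hδ.le
        exact_mod_cast this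
      exact ⟨K.prec_mono hle h1, K.prec_mono hle h2⟩
    simp only [prec_iff_logPrec] at hε
    refine ⟨_, K.isBisimulation_logicalEquivalence, fun φ => ⟨fun hm => ?_, fun hn => ?_⟩⟩
    · exact K.iInter_sem_shift_subset φ (mem_iInter.2 fun k => (hε k).2 φ hm)
    · exact K.iInter_sem_shift_subset φ (mem_iInter.2 fun k => (hε k).1 φ hn)
  · intro h
    have hle : ∀ x y, K.Bisimilar x y → K.Prec 0 x y := by
      intro x y hxy
      refine ⟨K.Bisimilar, ⟨?_, ?_⟩, hxy⟩
      · exact fun _ _ _ _ hm hn h => hm.symm.trans (h.trans hn)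
      · intro a b hab C hC
        obtain ⟨φ, rfl⟩ := hC.exists_sem
        have h1 := K.isBisimulation_bisimilar a b hab _ (K.measurableSet_sem φ)
          fun u hu v huv => huv.mem_sem hu
        have h2 : (K.θ a).real (K.sem φ) ≤
            (K.θ a).real (lowerClosure K.Bisimilar (K.sem φ)) :=
          measureReal_mono fun u hu => ⟨u, hu, .refl K u⟩
        rw [measureReal_def, ← h1, ← measureReal_def]
        simpa using h2
    refine le_antisymm ?_ (K.d_nonneg m n)
    exact csInf_le (K.bddBelow_distSet m n) ⟨0, by simp, hle m n h, hle n m h.symm⟩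

end CMK

theorem mainTheorem5 {M : Type u} [TopologicalSpace M] [MeasurableSpace M] [BorelSpace M]
    (K : CMK M) :
    (∀ m n : M, (K.distSet m n).Nonempty) ∧
    (∀ m n : M, 0 ≤ K.d m n) ∧
    (∀ m : M, K.d m m = 0) ∧
    (∀ m n : M, K.d m n = K.d n m) ∧
    (∀ m n o : M, K.d m o ≤ K.d m n + K.d n o) ∧
    (∀ m n : M, K.d m n = 0 ↔ K.Bisimilar m n) :=
  ⟨K.distSet_nonempty, K.d_nonneg, fun m => (K.d_eq_zero_iff m m).2 (.refl K m), K.d_comm,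
    K.d_triangle, K.d_eq_zero_iff⟩
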